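/- Let $X$ be a complex Banach space, $B(X)$ the Banach algebra of bounded linear operators on $X$, and $R(T)$ the range of $T\in B(X)$. Let $\sigma(T)$ be the spectrum of $T$ and $\sigma_{su}(T)=\{\lambda\in\mathbb{C} : \lambda-T \text{ is not surjective}\}$ its surjectivity spectrum. The descent $d(T)\in\{0,1,2,\dots\}\cup\{\infty\}$ of a bounded operator $T$ on a complex Banach space is the least $q\ge 0$ with $R(T^q)=R(T^{q+1})$, and $d(T)=\infty$ if there is no such $q$. The descent spectrum of $T\in B(X)$ is $\sigma_{desc}(T)=\{\lambda\in\mathbb{C} : d(\lambda-T)=\infty\}$. For $A\in B(X)$ let $L_A:B(X)\to B(X)$, $L_A(S)=AS$, be the left multiplication operator. The descent spectrum of $T$ as an element of the Banach algebra $B(X)$ is $\sigma_{desc}(T,B(X))=\{\lambda\in\mathbb{C} : d(L_{T-\lambda})=\infty\}$. Theorem. Let $T\in B(X)$ and let $D\subseteq\mathbb{C}$ be a closed set such that $\sigma(T)=\sigma_{su}(T)\cup D$. Then $$\sigma_{desc}(T)\cup \operatorname{int}(D)=\sigma_{desc}(T,B(X))\cup \operatorname{int}(D).$$ -/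

import Mathlib

/-- The surjectivity spectrum of a bounded operator: all `z` such that `z - T` is not onto. -/
def surjectivitySpectrum {X : Type*} [NormedAddCommGroup X] [NormedSpace ℂ X]
    (T : X →L[ℂ] X) : Set ℂ :=
  {z : ℂ | ¬ Function.Surjective (algebraMap ℂ (X →L[ℂ] X) z - T)}

/-- The descent of a bounded operator: the least `q` with `R(T ^ q) = R(T ^ (q + 1))`, and `⊤`
if there is no such `q` (an infimum over the empty family in `ℕ∞` is `⊤`). -/
noncomputable def operatorDescent {X : Type*} [NormedAddCommGroup X] [NormedSpace ℂ X]
    (T : X →L[ℂ] X) : ℕ∞ :=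
  ⨅ (q : ℕ) (_ : Set.range ⇑(T ^ q) = Set.range ⇑(T ^ (q + 1))), (q : ℕ∞)

/-- The descent spectrum of a bounded operator: all `z` such that `z - T` has infinite descent. -/
def operatorDescentSpectrum {X : Type*} [NormedAddCommGroup X] [NormedSpace ℂ X]
    (T : X →L[ℂ] X) : Set ℂ :=
  {z : ℂ | operatorDescent (algebraMap ℂ (X →L[ℂ] X) z - T) = ⊤}

/-- The descent of an element `a` of a unital complex normed algebra: the descent of the left
multiplication operator `x ↦ a * x`. -/
noncomputable def elementDescent {A : Type*} [NormedRing A] [NormedAlgebra ℂ A] (a : A) : ℕ∞ :=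
  operatorDescent (ContinuousLinearMap.mul ℂ A a)

/-- The descent spectrum of an element of a unital complex normed algebra: all `z` such that
`a - z` has infinite descent. -/
def elementDescentSpectrum {A : Type*} [NormedRing A] [NormedAlgebra ℂ A] (a : A) : Set ℂ :=
  {z : ℂ | elementDescent (a - algebraMap ℂ A z) = ⊤}

open Function Metric

/-! Only `σ_desc(T, B(X)) ⊆ σ_desc(T) ∪ int D` needs work. Let `A = T - z` have finite descent `q`,
with `z ∉ int D`. Then `A` induces a surjection `Â` on `X ⧸ ker A^q`, and `Â - μ` stays onto, with a
uniform lower bound, for small `μ`. For `μ ≠ 0` this lifts to `A - μ`. Choosing `z + μ ∉ D`, the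
hypothesis on the spectrum makes `A - μ` injective, hence `Â - μ` too; letting `μ → 0`, the uniform
bound makes `Â` injective. Inverting `Â` yields `A^q = A^(q+1) S`, which says that `L_A` has finite
descent. -/

/-- The lower bound of a surjective operator on a Banach space is stable under small scalar
perturbations. -/
lemma exists_preimage_sub_smul_norm_le {E : Type*} [NormedAddCommGroup E] [NormedSpace ℂ E]
    [CompleteSpace E] (A : E →L[ℂ] E) (hA : Surjective A) :
    ∃ C > 0, ∃ δ > 0, ∀ μ : ℂ, ‖μ‖ < δ → ∀ y, ∃ x, A x - μ • x = y ∧ ‖x‖ ≤ C * ‖y‖ := by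
  obtain ⟨R, hR⟩ := A.exists_nonlinearRightInverse_of_surjective (LinearMap.range_eq_top.2 hA)
  set N : ℝ := (R.nnnorm : ℝ)⁻¹ with hN
  have hN0 : 0 < N := inv_pos.2 (by exact_mod_cast hR)
  -- Perturbing by `‖μ‖ < N / 2` costs at most half of the bound `N`.
  refine ⟨2 / N, by positivity, N / 2, by positivity, fun μ hμ y => ?_⟩
  have happ : ApproximatesLinearOn (fun x => A x - μ • x) A Set.univ ‖μ‖₊ := by
    intro x _ z _
    have : (A x - μ • x) - (A z - μ • z) - A (x - z) = -(μ • (x - z)) := by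
      rw [map_sub, smul_sub]; abel
    rw [this, norm_neg, norm_smul, coe_nnnorm]
  have hr : 0 ≤ 2 / N * ‖y‖ := by positivity
  have hsurj := happ.surjOn_closedBall_of_nonlinearRightInverse R hr
    (Set.subset_univ (closedBall (0 : E) _))
  have hy : y ∈ closedBall (A 0 - μ • (0 : E))
      (((R.nnnorm : ℝ)⁻¹ - ‖μ‖₊) * (2 / N * ‖y‖)) := by
    have h1 : N / 2 * (2 / N * ‖y‖) = ‖y‖ := by field_simp
    have h2 : N / 2 * (2 / N * ‖y‖) ≤ (N - ‖μ‖) * (2 / N * ‖y‖) :=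
      mul_le_mul_of_nonneg_right (by linarith) hr
    simpa [← hN] using h1.symm.le.trans h2
  obtain ⟨x, hx, hxy⟩ := hsurj hy
  exact ⟨x, hxy, by simpa using hx⟩

/-- A surjective operator on a Banach space with arbitrarily small injective scalar perturbations
is injective. -/
lemma injective_of_surjective_of_small_perturbations {E : Type*} [NormedAddCommGroup E]
    [NormedSpace ℂ E] [CompleteSpace E] (A : E →L[ℂ] E) (hA : Surjective A)
    (h : ∀ ε > 0, ∃ μ : ℂ, ‖μ‖ < ε ∧ Injective fun x => A x - μ • x) : Injective A := by
  obtain ⟨C, hC, δ, hδ, hpre⟩ := exists_preimage_sub_smul_norm_le A hA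
  obtain ⟨μ, hμ, hinj⟩ := h (min δ C⁻¹) (by positivity)
  refine (injective_iff_map_eq_zero A).2 fun x hx => ?_
  obtain ⟨z, hz, hzn⟩ := hpre μ (hμ.trans_le (min_le_left _ _)) (A x - μ • x)
  obtain rfl : z = x := hinj hz
  rw [hx, zero_sub, norm_neg, norm_smul, ← mul_assoc] at hzn
  -- `hzn` now reads `‖x‖ ≤ C * ‖μ‖ * ‖x‖`, which forces `x = 0`.
  have : C * ‖μ‖ < 1 := by
    have := mul_lt_mul_of_pos_left (hμ.trans_le (min_le_right _ _)) hC
    rwa [mul_inv_cancel₀ hC.ne'] at this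
  by_contra hne
  have := mul_lt_mul_of_pos_right this (norm_pos_iff.2 hne)
  linarith

section

variable {X : Type*} [NormedAddCommGroup X] [NormedSpace ℂ X]

/-- The operator induced by `A` on the quotient by `ker (A ^ q)`. -/
noncomputable def quotientKerPow (A : X →L[ℂ] X) (q : ℕ) :
    (X ⧸ (A ^ q).ker) →L[ℂ] (X ⧸ (A ^ q).ker) :=
  (A ^ q).ker.liftQL ((A ^ q).ker.mkQL.comp A) <| by
    intro x hx
    have hx' : (A ^ q) x = 0 := hx
    have : (A ^ q) (A x) = 0 := by
      rw [← mul_apply_eq_comp, ← pow_succ, pow_succ', mul_apply_eq_comp,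
        hx', map_zero]
    exact LinearMap.mem_ker.2 ((Submodule.Quotient.mk_eq_zero _).2 this)

lemma quotientKerPow_mkQ (A : X →L[ℂ] X) (q : ℕ) (x : X) :
    quotientKerPow A q ((A ^ q).ker.mkQ x) = (A ^ q).ker.mkQ (A x) := by
  simp [quotientKerPow]

lemma mkQ_ker_pow_eq_iff (A : X →L[ℂ] X) (q : ℕ) (x y : X) :
    (A ^ q).ker.mkQ x = (A ^ q).ker.mkQ y ↔ (A ^ q) x = (A ^ q) y := by
  rw [Submodule.mkQ_apply, Submodule.mkQ_apply, Submodule.Quotient.eq, LinearMap.mem_ker,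
    map_sub, sub_eq_zero]
  rfl

lemma quotientKerPow_surjective (A : X →L[ℂ] X) (q : ℕ)
    (hq : Set.range ⇑(A ^ q) = Set.range ⇑(A ^ (q + 1))) : Surjective (quotientKerPow A q) := by
  intro y
  obtain ⟨y, rfl⟩ := (A ^ q).ker.mkQ_surjective y
  obtain ⟨z, hz⟩ := hq ▸ Set.mem_range_self (f := ⇑(A ^ q)) y
  refine ⟨(A ^ q).ker.mkQ z, ?_⟩
  rw [quotientKerPow_mkQ, mkQ_ker_pow_eq_iff, ← hz, pow_succ]
  rfl

/-- `A - μ` divides `A^q - μ^q`, which acts on `k` as the nonzero scalar `-μ^q`. -/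
lemma exists_sub_smul_eq_of_pow_apply_eq_zero (A : X →L[ℂ] X) (q : ℕ) {μ : ℂ} (hμ : μ ≠ 0)
    {k : X} (hk : (A ^ q) k = 0) : ∃ x, A x - μ • x = k := by
  obtain ⟨P, hP⟩ := (Algebra.commute_algebraMap_right μ A).sub_dvd_pow_sub_pow q
  have := congrArg (fun B : X →L[ℂ] X => B k) hP
  simp only [← map_pow, sub_apply, mul_apply_eq_comp, hk,
    ContinuousLinearMap.algebraMap_apply, zero_sub] at this
  refine ⟨-(μ ^ q)⁻¹ • P k, ?_⟩
  rw [map_smul, smul_comm, ← smul_sub, ← this, neg_smul, smul_neg, neg_neg, smul_smul,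
    inv_mul_cancel₀ (pow_ne_zero _ hμ), one_smul]

/-- Lifting a solution from the quotient leaves an error in `ker A^q`, which lies in the range of `A
- μ`. -/
lemma sub_smul_surjective_of_quotientKerPow (A : X →L[ℂ] X) (q : ℕ) {μ : ℂ} (hμ : μ ≠ 0)
    (h : Surjective fun x => quotientKerPow A q x - μ • x) : Surjective fun x => A x - μ • x := by
  intro y
  obtain ⟨z, hz⟩ := h ((A ^ q).ker.mkQ y)
  obtain ⟨z, rfl⟩ := (A ^ q).ker.mkQ_surjective z
  simp only [quotientKerPow_mkQ, ← map_smul, ← map_sub] at hz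
  rw [mkQ_ker_pow_eq_iff] at hz
  obtain ⟨x, hx⟩ := exists_sub_smul_eq_of_pow_apply_eq_zero A q hμ (k := y - (A z - μ • z))
    (by rw [map_sub, hz, sub_self])
  refine ⟨x + z, ?_⟩
  simp only [map_add, smul_add]
  rw [add_sub_add_comm, hx, sub_add_cancel]

/-- The quotient is a copy of `R(A^q)`, on which `A - μ` is just restricted. -/
lemma quotientKerPow_sub_smul_injective (A : X →L[ℂ] X) (q : ℕ) {μ : ℂ}
    (h : Injective fun x => A x - μ • x) :
    Injective fun x => quotientKerPow A q x - μ • x := by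
  intro x y hxy
  obtain ⟨x, rfl⟩ := (A ^ q).ker.mkQ_surjective x
  obtain ⟨y, rfl⟩ := (A ^ q).ker.mkQ_surjective y
  simp only [quotientKerPow_mkQ, ← map_smul, ← map_sub] at hxy
  rw [mkQ_ker_pow_eq_iff] at hxy ⊢
  apply h
  have hcomm : ∀ z, (A ^ q) (A z) = A ((A ^ q) z) := fun z => by
    rw [← mul_apply_eq_comp, ← pow_succ, pow_succ', mul_apply_eq_comp]
  simpa only [map_sub, map_smul, hcomm] using hxy

/-- If the operator induced on `X ⧸ ker (A ^ q)` is bijective, then `A ^ q` is a right multiple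
of `A ^ (q + 1)`. -/
lemma exists_pow_eq_pow_succ_mul_of_quotientKerPow_bijective [CompleteSpace X] (A : X →L[ℂ] X)
    (q : ℕ) (h : Bijective (quotientKerPow A q)) : ∃ S, A ^ q = A ^ (q + 1) * S := by
  have hclosed : IsClosed ((A ^ q).ker : Set X) := (A ^ q).isClosed_ker
  let e := ContinuousLinearEquiv.ofBijective (quotientKerPow A q)
    (LinearMap.ker_eq_bot.2 h.1) (LinearMap.range_eq_top.2 h.2)
  let J : (X ⧸ (A ^ q).ker) →L[ℂ] X := (A ^ q).ker.liftQL (A ^ q) le_rfl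
  have hJ : ∀ x, J ((A ^ q).ker.mkQ x) = (A ^ q) x := fun _ => rfl
  have hAJ : ∀ (n : ℕ) x, (A ^ n) (J x) = J ((quotientKerPow A q ^ n) x) := by
    intro n
    induction n with
    | zero => simp
    | succ n ih =>
      intro x
      rw [pow_succ, pow_succ, mul_apply_eq_comp, mul_apply_eq_comp, ← ih]
      obtain ⟨x, rfl⟩ := (A ^ q).ker.mkQ_surjective x
      rw [quotientKerPow_mkQ, hJ, hJ, ← mul_apply_eq_comp A, ← pow_succ', pow_succ]
      rfl
  have hinv : ∀ (n : ℕ) x,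
      (quotientKerPow A q ^ n) (((e.symm : _ →L[ℂ] X ⧸ (A ^ q).ker) ^ n) x) = x := by
    have h1 : quotientKerPow A q * (e.symm : _ →L[ℂ] X ⧸ (A ^ q).ker) = 1 := by
      ext1 x
      exact e.apply_symm_apply x
    intro n x
    rw [← mul_apply_eq_comp, pow_mul_pow_eq_one n h1]
    rfl
  -- `J` intertwines `Â` with `A`, so with `π` the quotient map, `A^(q+1) J Â^(-(q+1)) π = J π =
  -- A^q`.
  refine ⟨J.comp (((e.symm : _ →L[ℂ] X ⧸ (A ^ q).ker) ^ (q + 1)).comp (A ^ q).ker.mkQL), ?_⟩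
  ext x
  rw [mul_apply_eq_comp, ContinuousLinearMap.comp_apply, hAJ,
    ContinuousLinearMap.comp_apply, hinv, Submodule.mkQL_apply, hJ]

/-- An operator `A` with finite descent `q`, such that for some arbitrarily small nonzero `μ` the
operator `A - μ` is injective if surjective, satisfies `A ^ q = A ^ (q + 1) * S` for some `S`. -/
lemma exists_pow_eq_pow_succ_mul [CompleteSpace X] (A : X →L[ℂ] X) (q : ℕ)
    (hq : Set.range ⇑(A ^ q) = Set.range ⇑(A ^ (q + 1)))
    (h : ∀ ε > 0, ∃ μ : ℂ, μ ≠ 0 ∧ ‖μ‖ < ε ∧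
      (Surjective (fun x => A x - μ • x) → Injective (fun x => A x - μ • x))) :
    ∃ S, A ^ q = A ^ (q + 1) * S := by
  have hclosed : IsClosed ((A ^ q).ker : Set X) := (A ^ q).isClosed_ker
  have hsurj := quotientKerPow_surjective A q hq
  refine exists_pow_eq_pow_succ_mul_of_quotientKerPow_bijective A q ⟨?_, hsurj⟩
  refine injective_of_surjective_of_small_perturbations _ hsurj fun ε hε => ?_
  obtain ⟨C, -, δ, hδ, hpre⟩ := exists_preimage_sub_smul_norm_le _ hsurj
  obtain ⟨μ, hμ0, hμ, hμA⟩ := h (min ε δ) (by positivity)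
  refine ⟨μ, hμ.trans_le (min_le_left _ _), quotientKerPow_sub_smul_injective A q (hμA ?_)⟩
  refine sub_smul_surjective_of_quotientKerPow A q hμ0 fun y => ?_
  obtain ⟨x, hx, -⟩ := hpre μ (hμ.trans_le (min_le_right _ _)) y
  exact ⟨x, hx⟩

lemma operatorDescent_eq_top_iff (A : X →L[ℂ] X) :
    operatorDescent A = ⊤ ↔ ∀ q : ℕ, Set.range ⇑(A ^ q) ≠ Set.range ⇑(A ^ (q + 1)) := by
  simp [operatorDescent, iInf_eq_top]

lemma range_neg_pow (A : X →L[ℂ] X) (q : ℕ) :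
    Set.range ⇑((-A) ^ q) = Set.range ⇑(A ^ q) := by
  rcases q.even_or_odd with h | h
  · rw [h.neg_pow]
  rw [h.neg_pow]
  ext y
  constructor <;> rintro ⟨x, rfl⟩ <;> exact ⟨-x, by simp⟩

lemma operatorDescent_neg (A : X →L[ℂ] X) : operatorDescent (-A) = operatorDescent A := by
  simp only [operatorDescent, range_neg_pow]

end

lemma mul_pow_apply {B : Type*} [NormedRing B] [NormedAlgebra ℂ B] (a : B) (q : ℕ) (x : B) :
    (ContinuousLinearMap.mul ℂ B a ^ q) x = a ^ q * x := by
  induction q generalizing x with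
  | zero => simp
  | succ q ih => rw [pow_succ, mul_apply_eq_comp, ih, pow_succ, mul_assoc]; rfl

/-- Both ranges are principal right ideals, so it suffices to test the generator `a^q`. -/
lemma range_mul_pow_eq_iff {B : Type*} [NormedRing B] [NormedAlgebra ℂ B] (a : B) (q : ℕ) :
    Set.range ⇑(ContinuousLinearMap.mul ℂ B a ^ q) =
      Set.range ⇑(ContinuousLinearMap.mul ℂ B a ^ (q + 1)) ↔ ∃ s, a ^ q = a ^ (q + 1) * s := by
  constructor
  · intro h
    obtain ⟨s, hs⟩ := h ▸ Set.mem_range_self (f := ⇑(ContinuousLinearMap.mul ℂ B a ^ q)) 1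
    refine ⟨s, ?_⟩
    rw [mul_pow_apply, mul_pow_apply, mul_one] at hs
    exact hs.symm
  · rintro ⟨s, hs⟩
    ext y
    constructor
    · rintro ⟨x, rfl⟩
      exact ⟨s * x, by rw [mul_pow_apply, mul_pow_apply, ← mul_assoc, ← hs]⟩
    · rintro ⟨x, rfl⟩
      exact ⟨a * x, by rw [mul_pow_apply, mul_pow_apply, ← mul_assoc, ← pow_succ]⟩

lemma elementDescent_eq_top_iff {B : Type*} [NormedRing B] [NormedAlgebra ℂ B] (a : B) :
    elementDescent a = ⊤ ↔ ∀ q : ℕ, ¬ ∃ s, a ^ q = a ^ (q + 1) * s := by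
  simp only [elementDescent, operatorDescent_eq_top_iff, ne_eq, range_mul_pow_eq_iff]

lemma mem_operatorDescentSpectrum_iff {X : Type*} [NormedAddCommGroup X] [NormedSpace ℂ X]
    (T : X →L[ℂ] X) (z : ℂ) : z ∈ operatorDescentSpectrum T ↔
      operatorDescent (T - algebraMap ℂ (X →L[ℂ] X) z) = ⊤ := by
  rw [← operatorDescent_neg, neg_sub]
  rfl

lemma operatorDescentSpectrum_subset_elementDescentSpectrum {X : Type*} [NormedAddCommGroup X]
    [NormedSpace ℂ X] (T : X →L[ℂ] X) :
    operatorDescentSpectrum T ⊆ elementDescentSpectrum (A := X →L[ℂ] X) T := by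
  intro z hz
  rw [mem_operatorDescentSpectrum_iff, operatorDescent_eq_top_iff] at hz
  refine (elementDescent_eq_top_iff _).2 fun q => ?_
  rintro ⟨S, hS⟩
  refine hz q (Set.Subset.antisymm ?_ ?_)
  · rintro _ ⟨x, rfl⟩
    exact ⟨S x, by rw [← mul_apply_eq_comp, ← hS]⟩
  · rintro _ ⟨x, rfl⟩
    exact ⟨(T - algebraMap ℂ (X →L[ℂ] X) z) x, by
      rw [← mul_apply_eq_comp, ← pow_succ]⟩

lemma exists_small_add_notMem {D : Set ℂ} (hD : IsClosed D) {z : ℂ} (hz : z ∉ interior D)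
    {ε : ℝ} (hε : 0 < ε) : ∃ μ : ℂ, μ ≠ 0 ∧ ‖μ‖ < ε ∧ z + μ ∉ D := by
  have hcl : z ∈ closure Dᶜ := by rwa [closure_compl]
  obtain ⟨w, hw, hwz⟩ := Metric.mem_closure_iff.1 hcl (ε / 2) (by positivity)
  obtain ⟨r, hr, hball⟩ := Metric.isOpen_iff.1 hD.isOpen_compl w hw
  -- If `z` itself is outside `D`, a small real shift keeps `μ ≠ 0`.
  by_cases hwz' : w = z
  · subst hwz'
    have hm : ‖((min r ε / 2 : ℝ) : ℂ)‖ = min r ε / 2 := by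
      rw [Complex.norm_real, Real.norm_of_nonneg (by positivity)]
    have hpos : 0 < min r ε := by positivity
    refine ⟨((min r ε / 2 : ℝ) : ℂ), ?_, ?_, hball ?_⟩
    · rw [← norm_pos_iff, hm]; positivity
    · rw [hm]; linarith [min_le_right r ε]
    · rw [mem_ball, dist_eq_norm, add_sub_cancel_left, hm]; linarith [min_le_left r ε]
  · refine ⟨w - z, sub_ne_zero.2 hwz', ?_, by rwa [add_sub_cancel]⟩
    rw [← dist_eq_norm, dist_comm]
    linarith

theorem theorem1 {X : Type*} [NormedAddCommGroup X] [NormedSpace ℂ X] [CompleteSpace X]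
    (T : X →L[ℂ] X) (D : Set ℂ) (hD : IsClosed D)
    (hT : spectrum ℂ T = surjectivitySpectrum T ∪ D) :
    operatorDescentSpectrum T ∪ interior D =
      elementDescentSpectrum (A := X →L[ℂ] X) T ∪ interior D := by
  refine Set.Subset.antisymm (Set.union_subset_union_left _
    (operatorDescentSpectrum_subset_elementDescentSpectrum T)) ?_
  rintro z (hz | hz)
  swap
  · exact Or.inr hz
  by_cases hzD : z ∈ interior D
  · exact Or.inr hzD
  refine Or.inl ((mem_operatorDescentSpectrum_iff T z).2 ((operatorDescent_eq_top_iff _).2 ?_))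
  intro q hq
  refine (elementDescent_eq_top_iff _).1 hz q (exists_pow_eq_pow_succ_mul _ q hq fun ε hε => ?_)
  obtain ⟨μ, hμ0, hμ, hμD⟩ := exists_small_add_notMem hD hzD hε
  refine ⟨μ, hμ0, hμ, fun hsurj => ?_⟩
  have hfun : ∀ x, (T - algebraMap ℂ (X →L[ℂ] X) z) x - μ • x =
      -(algebraMap ℂ (X →L[ℂ] X) (z + μ) - T) x := fun x => by
    simp [ContinuousLinearMap.algebraMap_apply]
    abel
  simp only [hfun] at hsurj ⊢
  have hspec : z + μ ∉ spectrum ℂ T := by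
    rw [hT]
    rintro (h | h)
    · refine h fun y => ?_
      obtain ⟨x, hx⟩ := hsurj (-y)
      exact ⟨x, neg_injective hx⟩
    · exact hμD h
  obtain ⟨S, hS⟩ := (spectrum.notMem_iff.1 hspec).exists_left_inv
  refine neg_injective.comp (LeftInverse.injective (g := S) fun x => ?_)
  rw [← mul_apply_eq_comp, hS]
  rfl
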